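/- Let $X$ be a real reflexive Banach space with dual $X^*$ and pairing $\langle\cdot,\cdot\rangle$. For a set-valued operator $A:X\rightrightarrows X^*$ write $\operatorname{gra}A=\{(x,x^*): x^*\in Ax\}$ and $\operatorname{dom}A=\{x: Ax\ne\varnothing\}$. $A$ is a linear relation if $\operatorname{gra}A$ is a linear subspace of $X\times X^*$, monotone if $\langle x-y,x^*-y^*\rangle\ge 0$ for all $(x,x^*),(y,y^*)\in\operatorname{gra}A$, and maximally monotone if it is monotone and has no proper monotone extension. Its Fitzpatrick function is $F_A(x,x^*)=\sup_{(a,a^*)\in\operatorname{gra}A}\big(\langle x,a^*\rangle+\langle a,x^*\rangle-\langle a,a^*\rangle\big)$. For $C\subseteq X$ let $\iota_C$ be the indicator function ($0$ on $C$, $+\infty$ elsewhere), $\sigma_C(x^*)=\sup_{c\in C}\langle c,x^*\rangle$, and let $N_C$ be the normal cone operator: $N_C(x)=\{x^*:\langle c-x,x^*\rangle\le 0\ \forall c\in C\}$ if $x\in C$, and $N_C(x)=\varnothing$ otherwise. For $F:X\times X^*\to[-\infty,+\infty]$ put $F^*(x^*,x)=\sup_{(y,y^*)\in X\times X^*}\big(\langle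 y,x^*\rangle+\langle x,y^*\rangle-F(y,y^*)\big)$ and $\operatorname{pos}F=\{(x,x^*):F(x,x^*)=\langle x,x^*\rangle\}$. $F$ is a BC-function if it is proper (never $-\infty$, not identically $+\infty$), convex, and $F^*(x^*,x)\ge F(x,x^*)\ge\langle x,x^*\rangle$ for all $(x,x^*)\in X\times X^*$. Finally $(F_1\Box_2F_2)(x,x^*)=\inf_{v^*\in X^*}\big(F_1(x,x^*-v^*)+F_2(x,v^*)\big)$. **Theorem 4.3.** Let $A:X\rightrightarrows X^*$ be a maximally monotone linear relation that is at most single-valued, and let $C\ne\{0\}$ be a bounded closed convex subset of $X$ such that $\bigcup_{\lambda>0}\lambda[\operatorname{dom}A-C]$ is a closed subspace of $X$. Let $j:[0,+\infty[\to[0,+\infty[$ be increasing (not necessarily strictly) with $j(\gamma)\ge\gamma$ for every $\gamma\ge0$. Then the following hold. 1. $F_A$ and $F_{N_C}$ are BC-functions, and $F_{N_C}(x,x^*)=\iota_C(x)+\sigma_C(x^*)$ for all $(x,x^*)\in X\times X^*$. 2. For all $(x,x^*,y^*)\in X\times X^*\times X^*$, $F_A^*(x^*,x)+F_{N_C}^*(y^*-x^*,x)=\iota_{\operatorname{gra}A\cap(C\times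 X^*)}(x,x^*)+\langle x,x^*\rangle+\sigma_C(y^*-x^*)$. 3. For every $(x,x^*)\in X\times X^*$, $(F_A\Box_2F_{N_C})^*(x^*,x)=\langle x,Ax\rangle+\sigma_C(x^*-Ax)$ if $x\in C\cap\operatorname{dom}A$, and $(F_A\Box_2F_{N_C})^*(x^*,x)=+\infty$ otherwise. 4. There exists $(z,z^*)\in X\times X^*$ such that $z\in\operatorname{dom}A\cap C$ and $\sigma_C(z^*-Az)>0$. 5. If $(z,z^*)\in X\times X^*$ satisfies $z\in\operatorname{dom}A\cap C$ and $\sigma_C(z^*-Az)>0$, then $F_A^*(x^*,z)+F_{N_C}^*(z^*-x^*,z)>(F_A\Box_2F_{N_C})^*(x^*,z)$ for every $x^*\in X^*$. 6. Suppose moreover that $X$ is a Hilbert space and $C=B_X$ is the closed unit ball. If $(x,x^*)\in\operatorname{pos}F_A$, $(y,y^*)\in\operatorname{pos}F_{N_C}$, $x\ne y$ and $\langle x-y,y^*\rangle=\|x-y\|\cdot\|y^*\|$, then $\|y^*\|\le\|x^*+y^*\|\le j\big(\|x\|+\|x^*+y^*\|+\|y\|+\|x-y\|\cdot\|y^*\|\big)$.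 -/

import Mathlib

open scoped NNReal Pointwise

namespace BCFunctions

noncomputable section

/-- A real normed space is reflexive: the canonical map into the bidual is onto. -/
def IsReflexiveSpace (X : Type*) [NormedAddCommGroup X] [NormedSpace ℝ X] : Prop :=
  Function.Surjective (NormedSpace.inclusionInDoubleDual ℝ X)

/-- The norm of `X` comes from an inner product. Together with completeness of `X` this says
that `X` is a Hilbert space. -/
def HasHilbertNorm (X : Type*) [NormedAddCommGroup X] [inst : NormedSpace ℝ X] : Prop :=
  ∃ ip : InnerProductSpace ℝ X, ip.toNormedSpace = inst

/-! ### Extended-real-valued functions -/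

/-- Indicator function `ι_S` of a set: `0` on `S` and `+∞` off `S`. -/
def indicatorFn {E : Type*} (S : Set E) (x : E) : EReal :=
  open Classical in if x ∈ S then 0 else ⊤

/-- Support function `σ_C` of a set. -/
def supportFn {X : Type*} [NormedAddCommGroup X] [NormedSpace ℝ X] (C : Set X)
    (xs : StrongDual ℝ X) : EReal :=
  ⨆ c ∈ C, ((xs c : ℝ) : EReal)

/-- Fenchel conjugate `f^*` of an extended-real-valued function. -/
def fenchelConj {E : Type*} [NormedAddCommGroup E] [NormedSpace ℝ E] (f : E → EReal)
    (es : StrongDual ℝ E) : EReal :=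
  ⨆ e : E, ((es e : ℝ) : EReal) - f e

/-- Proper: never `-∞`, and not identically `+∞`. -/
def IsProper {E : Type*} (f : E → EReal) : Prop :=
  (∀ e, f e ≠ ⊥) ∧ ∃ e, f e ≠ ⊤

/-- Convexity of an extended-real-valued function: its epigraph is convex. -/
def IsConvexFn {E : Type*} [AddCommGroup E] [Module ℝ E] (f : E → EReal) : Prop :=
  Convex ℝ {p : E × ℝ | f p.1 ≤ (p.2 : EReal)}

/-- Partial inf-convolution `F₁ □₂ F₂` (in the second variable). -/
def partialInfConv {X Y : Type*} [AddGroup Y] (F₁ F₂ : X × Y → EReal) (p : X × Y) : EReal :=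
  ⨅ v : Y, F₁ (p.1, p.2 - v) + F₂ (p.1, v)

section Space

variable {X : Type*} [NormedAddCommGroup X] [NormedSpace ℝ X]

/-- The Fenchel conjugate of `F : X × X^* → [-∞, +∞]` at `(x^*, x) ∈ X^* × X`, where `(x^*, x)` is
the continuous functional `(y, y^*) ↦ ⟨y, x^*⟩ + ⟨x, y^*⟩` on `X × X^*`. -/
def pairConj (F : X × StrongDual ℝ X → EReal) (xs : StrongDual ℝ X) (x : X) : EReal :=
  fenchelConj F (xs.coprod (NormedSpace.inclusionInDoubleDual ℝ X x))

theorem pairConj_eq (F : X × StrongDual ℝ X → EReal) (xs : StrongDual ℝ X) (x : X) :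
    pairConj F xs x = ⨆ p : X × StrongDual ℝ X, ((xs p.1 + p.2 x : ℝ) : EReal) - F p := by
  simp [pairConj, fenchelConj]

/-- `pos F`, the set of pairs at which `F` agrees with the duality pairing. -/
def posSet (F : X × StrongDual ℝ X → EReal) : Set (X × StrongDual ℝ X) :=
  {p | F p = ((p.2 p.1 : ℝ) : EReal)}

/-- BC-functions ("bigger conjugate"). -/
def IsBC (F : X × StrongDual ℝ X → EReal) : Prop :=
  IsProper F ∧ IsConvexFn F ∧
    ∀ (x : X) (xs : StrongDual ℝ X),
      F (x, xs) ≤ pairConj F xs x ∧ ((xs x : ℝ) : EReal) ≤ F (x, xs)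

/-! ### Set-valued operators `X ⇉ X^*` -/

/-- Graph of a set-valued operator. -/
def gra (A : X → Set (StrongDual ℝ X)) : Set (X × StrongDual ℝ X) :=
  {p | p.2 ∈ A p.1}

/-- Domain of a set-valued operator. -/
def opDom (A : X → Set (StrongDual ℝ X)) : Set X :=
  {x | (A x).Nonempty}

/-- Monotone operators. -/
def IsMonotoneOp (A : X → Set (StrongDual ℝ X)) : Prop :=
  ∀ p ∈ gra A, ∀ q ∈ gra A, 0 ≤ (p.2 - q.2) (p.1 - q.1)

/-- Maximally monotone operators: no proper monotone extension. -/
def IsMaxMonotoneOp (A : X → Set (StrongDual ℝ X)) : Prop :=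
  IsMonotoneOp A ∧
    ∀ B : X → Set (StrongDual ℝ X), IsMonotoneOp B → gra A ⊆ gra B → gra B = gra A

/-- Linear relations: the graph is a linear subspace. -/
def IsLinearRel (A : X → Set (StrongDual ℝ X)) : Prop :=
  ∃ S : Submodule ℝ (X × StrongDual ℝ X), (S : Set (X × StrongDual ℝ X)) = gra A

/-- At most single-valued operators. -/
def IsAtMostSingleValued (A : X → Set (StrongDual ℝ X)) : Prop :=
  ∀ x, (A x).Subsingleton

/-- Normal cone operator `N_C`. -/
def normalCone (C : Set X) (x : X) : Set (StrongDual ℝ X) :=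
  {xs | x ∈ C ∧ ∀ c ∈ C, xs (c - x) ≤ 0}

/-- Fitzpatrick function `F_A`. -/
def fitzpatrick (A : X → Set (StrongDual ℝ X)) (p : X × StrongDual ℝ X) : EReal :=
  ⨆ a ∈ gra A, ((a.2 p.1 + p.2 a.1 - a.2 a.1 : ℝ) : EReal)

/-- A subset of `X` is a closed linear subspace. -/
def IsClosedSubspace (M : Set X) : Prop :=
  IsClosed M ∧ ∃ S : Submodule ℝ X, (S : Set X) = M

end Space

end

end BCFunctions

open BCFunctions

namespace BCFunctions

open Filter Topology

/-! ### Testing extended-real bounds against real numbers -/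

section ExtendedReals

/-! The graph of `A` is a closed subspace, so by reflexivity a pair off it is detected by some (z,
z*) annihilating the graph. `F_A` is at most 0 on the line through (z, z*), hence `F_A^*` is the
pairing on the graph and `+∞` off it (`mem_gra_of_pairConj_le`). Since `F_{N_C} = ι_C + σ_C` equals
its own conjugate, the sum formula follows.

The core is the conjugate of `F_A □₂ F_{N_C}`. Single-valuedness makes `dom A` dense, so the
constraint qualification says that `dom A - C` absorbs X. Baire's theorem then gives a ball where
values of `A` are uniformly bounded, and separating a perturbation epigraph gives exact Fenchel
duality (`exists_mem_gra_of_conj_restrict_le`). This conjugate is thus finite on all of `C ∩ dom A`,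
whereas the sum of conjugates is finite only when `x^* = Ax`; hence the strict gap.

The norm estimate is the equality case of the triangle inequality, which forces x to be a
nonnegative multiple of y. -/

theorem coe_sub_le_coe_iff (a m : ℝ) (y : EReal) :
    (a : EReal) - y ≤ m ↔ ∀ r : ℝ, y ≤ r → a - r ≤ m := by
  induction y using EReal.rec with
  | bot =>
    simp only [EReal.coe_sub_bot, top_le_iff, EReal.coe_ne_top, bot_le, forall_const, false_iff,
      not_forall, not_le]
    exact ⟨a - m - 1, by linarith⟩
  | coe y =>
    rw [← EReal.coe_sub, EReal.coe_le_coe_iff]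
    exact ⟨fun h r hr => by linarith [EReal.coe_le_coe_iff.1 hr], fun h => h y le_rfl⟩
  | top => simp

end ExtendedReals

/-! ### Separation and weak compactness -/

section Duality

variable {X : Type*} [NormedAddCommGroup X] [NormedSpace ℝ X]

/-- A closed subspace is the intersection of the kernels of the functionals vanishing on it. -/
theorem exists_dual_vanishing_of_notMem {S : Submodule ℝ X} (hS : IsClosed (S : Set X)) {x : X}
    (hx : x ∉ S) : ∃ f : StrongDual ℝ X, (∀ y ∈ S, f y = 0) ∧ f x ≠ 0 := by
  obtain ⟨f, u, hf, hu⟩ := geometric_hahn_banach_closed_point S.convex hS hx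
  have h0 : ∀ y ∈ S, f y = 0 := by
    intro y hy
    by_contra hne
    have h := hf (((u + 1) / f y) • y) (S.smul_mem _ hy)
    rw [map_smul, smul_eq_mul, div_mul_cancel₀ _ hne] at h
    linarith
  refine ⟨f, h0, fun h => ?_⟩
  have := hf 0 S.zero_mem
  rw [map_zero] at this
  linarith

/-- Functionals on `X × X^*` come from `X^* × X` when `X` is reflexive. -/
theorem exists_pair_vanishing_of_notMem (hX : IsReflexiveSpace X)
    {S : Submodule ℝ (X × StrongDual ℝ X)} (hS : IsClosed (S : Set (X × StrongDual ℝ X)))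
    {p : X × StrongDual ℝ X} (hp : p ∉ S) :
    ∃ (z : X) (zs : StrongDual ℝ X), (∀ a ∈ S, zs a.1 + a.2 z = 0) ∧ zs p.1 + p.2 z ≠ 0 := by
  obtain ⟨f, hf, hfp⟩ := exists_dual_vanishing_of_notMem hS hp
  obtain ⟨z, hz⟩ := hX (f.comp (ContinuousLinearMap.inr ℝ X (StrongDual ℝ X)))
  have key : ∀ a : X × StrongDual ℝ X,
      (f.comp (ContinuousLinearMap.inl ℝ X (StrongDual ℝ X))) a.1 + a.2 z = f a := by
    intro a
    have h := congrArg (fun φ => φ a.2) hz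
    simp only [NormedSpace.dual_def, ContinuousLinearMap.comp_apply,
      ContinuousLinearMap.inr_apply] at h
    rw [h, ContinuousLinearMap.comp_apply, ContinuousLinearMap.inl_apply, ← map_add]
    simp
  exact ⟨z, _, fun a ha => by rw [key, hf a ha], by rwa [key]⟩

/-- Banach-Alaoglu, in terms of pointwise limits along an ultrafilter. -/
theorem exists_dual_ultrafilter_limit {ι : Type*} (U : Ultrafilter ι) {w : ι → StrongDual ℝ X}
    {r : ℝ} (hw : ∀ i, ‖w i‖ ≤ r) :
    ∃ w₀ : StrongDual ℝ X, ‖w₀‖ ≤ r ∧ ∀ x, Tendsto (fun i => w i x) U (𝓝 (w₀ x)) := by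
  let g : ι → WeakDual ℝ X := fun i => WeakDual.toStrongDual.symm (w i)
  obtain ⟨v, hv, hlim⟩ := (WeakDual.isCompact_closedBall (𝕜 := ℝ) (0 : StrongDual ℝ X) r
    ).ultrafilter_le_nhds (U.map g) (by
      rw [le_principal_iff]
      exact Filter.mem_map.2 (univ_mem' fun i => by
        simpa [g] using hw i))
  refine ⟨WeakDual.toStrongDual v, by simpa using hv, fun x => ?_⟩
  exact ((WeakDual.eval_continuous x).tendsto v).comp (show Tendsto g U (𝓝 v) from hlim)

/-- Bounded closed convex subsets of a reflexive space are weakly compact. -/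
theorem exists_weak_ultrafilter_limit (hX : IsReflexiveSpace X) {C : Set X}
    (hCb : Bornology.IsBounded C) (hCcl : IsClosed C) (hCcv : Convex ℝ C) {ι : Type*}
    (U : Ultrafilter ι) {y : ι → X} (hy : ∀ i, y i ∈ C) :
    ∃ y₀ ∈ C, ∀ f : StrongDual ℝ X, Tendsto (fun i => f (y i)) U (𝓝 (f y₀)) := by
  obtain ⟨r, hr⟩ := hCb.exists_norm_le
  obtain ⟨φ, -, hφ⟩ := exists_dual_ultrafilter_limit U
    (w := fun i => NormedSpace.inclusionInDoubleDual ℝ X (y i)) (r := r)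
    (fun i => (NormedSpace.double_dual_bound ℝ X _).trans (hr _ (hy i)))
  obtain ⟨y₀, rfl⟩ := hX φ
  simp only [NormedSpace.dual_def] at hφ
  refine ⟨y₀, ?_, hφ⟩
  by_contra hy₀
  obtain ⟨f, u, hf, hu⟩ := geometric_hahn_banach_closed_point hCcv hCcl hy₀
  exact hu.not_ge (le_of_tendsto (hφ f) (Eventually.of_forall fun i => (hf _ (hy i)).le))

/-- A maximizing sequence has a weak limit in `C` along a free ultrafilter. At a maximizer `a`,
nonnegative multiples of `f` are normal to `C`. -/
theorem exists_isMaxOn_of_reflexive (hX : IsReflexiveSpace X) {C : Set X}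
    (hCb : Bornology.IsBounded C) (hCcl : IsClosed C) (hCcv : Convex ℝ C) (hne : C.Nonempty)
    (f : StrongDual ℝ X) : ∃ a ∈ C, ∀ c ∈ C, f c ≤ f a := by
  have hbdd : BddAbove (f '' C) := (f.lipschitz.isBounded_image hCb).bddAbove
  obtain ⟨u, -, hu, huC⟩ := exists_seq_tendsto_sSup (hne.image f) hbdd
  choose y hy hyu using huC
  obtain ⟨a, ha, hlim⟩ :=
    exists_weak_ultrafilter_limit hX hCb hCcl hCcv (hyperfilter ℕ) hy
  have h : f a = sSup (f '' C) := tendsto_nhds_unique (hlim f) (by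
    simp only [hyu]
    exact hu.mono_left Nat.hyperfilter_le_atTop)
  exact ⟨a, ha, fun c hc => h ▸ le_csSup hbdd ⟨c, hc, rfl⟩⟩

end Duality

/-! ### Indicator and support functions -/

section SupportFunctions

variable {X : Type*} [NormedAddCommGroup X] [NormedSpace ℝ X] {C : Set X}

theorem indicatorFn_of_mem {E : Type*} {S : Set E} {x : E} (hx : x ∈ S) : indicatorFn S x = 0 := by
  simp [indicatorFn, hx]

theorem indicatorFn_of_notMem {E : Type*} {S : Set E} {x : E} (hx : x ∉ S) :
    indicatorFn S x = ⊤ := by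
  simp [indicatorFn, hx]

theorem le_supportFn {c : X} (hc : c ∈ C) (f : StrongDual ℝ X) :
    ((f c : ℝ) : EReal) ≤ supportFn C f :=
  le_iSup₂ (f := fun c (_ : c ∈ C) => ((f c : ℝ) : EReal)) c hc

theorem supportFn_le_coe_iff {f : StrongDual ℝ X} {s : ℝ} :
    supportFn C f ≤ s ↔ ∀ c ∈ C, f c ≤ s := by
  simp [supportFn, iSup_le_iff]

theorem supportFn_ne_bot (hne : C.Nonempty) (f : StrongDual ℝ X) : supportFn C f ≠ ⊥ := by
  obtain ⟨c, hc⟩ := hne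
  exact ne_bot_of_le_ne_bot (EReal.coe_ne_bot _) (le_supportFn hc f)

theorem exists_supportFn_eq_coe (hCb : Bornology.IsBounded C) (hne : C.Nonempty)
    (f : StrongDual ℝ X) : ∃ s : ℝ, supportFn C f = s := by
  obtain ⟨s, hs⟩ := (f.lipschitz.isBounded_image hCb).bddAbove
  have h : supportFn C f ≤ s := supportFn_le_coe_iff.2 fun c hc => hs ⟨c, hc, rfl⟩
  exact ⟨_, (EReal.coe_toReal (ne_top_of_le_ne_top (EReal.coe_ne_top _) h)
    (supportFn_ne_bot hne f)).symm⟩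

end SupportFunctions

/-! ### Fitzpatrick functions of monotone operators -/

section Fitzpatrick

variable {X : Type*} [NormedAddCommGroup X] [NormedSpace ℝ X]
  {A : X → Set (StrongDual ℝ X)}

theorem fitzpatrick_le_coe_iff {p : X × StrongDual ℝ X} {r : ℝ} :
    fitzpatrick A p ≤ r ↔ ∀ a ∈ gra A, a.2 p.1 + p.2 a.1 - a.2 a.1 ≤ r := by
  simp only [fitzpatrick, iSup_le_iff, EReal.coe_le_coe_iff]

theorem le_fitzpatrick {a : X × StrongDual ℝ X} (ha : a ∈ gra A) (p : X × StrongDual ℝ X) :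
    ((a.2 p.1 + p.2 a.1 - a.2 a.1 : ℝ) : EReal) ≤ fitzpatrick A p :=
  le_iSup₂ (f := fun (a : X × StrongDual ℝ X) (_ : a ∈ gra A) =>
    ((a.2 p.1 + p.2 a.1 - a.2 a.1 : ℝ) : EReal)) a ha

theorem fitzpatrick_le_pairing (hA : IsMonotoneOp A) {p : X × StrongDual ℝ X} (hp : p ∈ gra A) :
    fitzpatrick A p ≤ ((p.2 p.1 : ℝ) : EReal) := by
  rw [fitzpatrick_le_coe_iff]
  intro a ha
  have := hA p hp a ha
  simp only [map_sub, sub_apply] at this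
  linarith

/-- Adjoining `p` to the graph keeps it monotone, so maximality leaves no room for a new point. -/
theorem mem_gra_of_monotonically_related (hA : IsMaxMonotoneOp A) {p : X × StrongDual ℝ X}
    (hp : ∀ a ∈ gra A, 0 ≤ (p.2 - a.2) (p.1 - a.1)) : p ∈ gra A := by
  let B : X → Set (StrongDual ℝ X) := fun x => {xs | (x, xs) ∈ gra A ∨ (x, xs) = p}
  have hB : ∀ q, q ∈ gra B ↔ q ∈ gra A ∨ q = p := fun q => Iff.rfl
  rw [← hA.2 B ?_ fun q hq => (hB q).2 (Or.inl hq), hB]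
  · exact Or.inr rfl
  · intro q hq q' hq'
    rw [hB] at hq hq'
    rcases hq with hq | rfl <;> rcases hq' with hq' | rfl
    · exact hA.1 q hq q' hq'
    · have := hp q hq
      rwa [← neg_sub q.1, ← neg_sub q.2, map_neg, neg_apply, neg_neg] at this
    · exact hp q' hq'
    · simp

theorem pairing_le_fitzpatrick (hA : IsMaxMonotoneOp A) (p : X × StrongDual ℝ X) :
    ((p.2 p.1 : ℝ) : EReal) ≤ fitzpatrick A p := by
  by_cases hp : p ∈ gra A
  · simpa using le_fitzpatrick hp p
  · by_contra! hlt
    refine hp (mem_gra_of_monotonically_related hA fun a ha => ?_)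
    have := fitzpatrick_le_coe_iff.1 hlt.le a ha
    simp only [map_sub, sub_apply]
    linarith

theorem isConvexFn_fitzpatrick : IsConvexFn (fitzpatrick A) := by
  intro p hp q hq s t hs ht hst
  simp only [Set.mem_ofPred_eq, fitzpatrick_le_coe_iff] at hp hq ⊢
  intro a ha
  have h₁ := mul_le_mul_of_nonneg_left (hp a ha) hs
  have h₂ := mul_le_mul_of_nonneg_left (hq a ha) ht
  have h₃ : a.2 a.1 = s * a.2 a.1 + t * a.2 a.1 := by rw [← add_mul, hst, one_mul]
  simp only [Prod.fst_add, Prod.smul_fst, Prod.snd_add, Prod.smul_snd, map_add, map_smul,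
    add_apply, smul_apply, smul_eq_mul]
  linarith

theorem pairConj_le_coe_iff {F : X × StrongDual ℝ X → EReal} {xs : StrongDual ℝ X} {x : X}
    {m : ℝ} : pairConj F xs x ≤ m ↔
      ∀ (p : X × StrongDual ℝ X) (r : ℝ), F p ≤ r → xs p.1 + p.2 x - r ≤ m := by
  simp only [pairConj_eq, iSup_le_iff, coe_sub_le_coe_iff]

/-- On the graph `F_A` is at most the pairing, so testing the conjugate only at graph points already
dominates the supremum defining `F_A`. -/
theorem fitzpatrick_le_pairConj (hA : IsMonotoneOp A) (x : X) (xs : StrongDual ℝ X) :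
    fitzpatrick A (x, xs) ≤ pairConj (fitzpatrick A) xs x := by
  rw [← EReal.le_of_forall_lt_iff_le]
  intro m hm
  rw [fitzpatrick_le_coe_iff]
  intro a ha
  have := pairConj_le_coe_iff.1 hm.le a _ (fitzpatrick_le_pairing hA ha)
  simp only
  linarith

/-- The lower bound `hF` replaces maximality, so that `normalCone C` is covered without proving it
maximal. -/
theorem isBC_fitzpatrick (hA : IsMonotoneOp A) (hne : (gra A).Nonempty)
    (hF : ∀ p : X × StrongDual ℝ X, ((p.2 p.1 : ℝ) : EReal) ≤ fitzpatrick A p) :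
    IsBC (fitzpatrick A) := by
  obtain ⟨a, ha⟩ := hne
  exact ⟨⟨fun p => ne_bot_of_le_ne_bot (EReal.coe_ne_bot _) (hF p),
    a, ne_top_of_le_ne_top (EReal.coe_ne_top _) (fitzpatrick_le_pairing hA ha)⟩,
    isConvexFn_fitzpatrick, fun x xs => ⟨fitzpatrick_le_pairConj hA x xs, hF (x, xs)⟩⟩

theorem isClosed_gra (hA : IsMaxMonotoneOp A) : IsClosed (gra A) := by
  have h : gra A = ⋂ a ∈ gra A, {p : X × StrongDual ℝ X | 0 ≤ (p.2 - a.2) (p.1 - a.1)} := by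
    ext p
    simp only [Set.mem_iInter]
    exact ⟨fun hp a ha => hA.1 p hp a ha, mem_gra_of_monotonically_related hA⟩
  rw [h]
  exact isClosed_biInter fun a _ => isClosed_le continuous_const (by fun_prop)

end Fitzpatrick

/-! ### The normal cone operator -/

section NormalCone

variable {X : Type*} [NormedAddCommGroup X] [NormedSpace ℝ X] {C : Set X}

theorem isMonotoneOp_normalCone : IsMonotoneOp (normalCone C) := by
  intro p hp q hq
  have h₁ := hp.2 q.1 hq.1
  have h₂ := hq.2 p.1 hp.1
  simp only [map_sub, sub_apply] at h₁ h₂ ⊢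
  linarith

theorem zero_mem_normalCone {x : X} (hx : x ∈ C) : (x, 0) ∈ gra (normalCone C) :=
  ⟨hx, fun _ _ => by simp⟩

theorem fitzpatrick_normalCone (hX : IsReflexiveSpace X) (hCb : Bornology.IsBounded C)
    (hCcl : IsClosed C) (hCcv : Convex ℝ C) (hne : C.Nonempty) (x : X) (xs : StrongDual ℝ X) :
    fitzpatrick (normalCone C) (x, xs) = indicatorFn C x + supportFn C xs := by
  by_cases hx : x ∈ C
  · rw [indicatorFn_of_mem hx, zero_add]
    apply le_antisymm
    · refine iSup₂_le fun a ha => le_trans ?_ (le_supportFn ha.1 xs)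
      have := ha.2 x hx
      rw [map_sub] at this
      exact EReal.coe_le_coe_iff.2 (by simp only; linarith)
    · exact iSup₂_le fun c hc => by simpa using le_fitzpatrick (zero_mem_normalCone hc) (x, xs)
  · rw [indicatorFn_of_notMem hx, EReal.top_add_of_ne_bot (supportFn_ne_bot hne xs)]
    rw [EReal.eq_top_iff_forall_lt]
    by_contra! h
    obtain ⟨m, hm⟩ := h
    rw [fitzpatrick_le_coe_iff] at hm
    obtain ⟨f, u, hf, hu⟩ := geometric_hahn_banach_closed_point hCcv hCcl hx
    obtain ⟨a, ha, hmax⟩ := exists_isMaxOn_of_reflexive hX hCb hCcl hCcv hne f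
    have hpos : 0 < f x - f a := by linarith [hf a ha]
    have hm₀ := hm (a, 0) (zero_mem_normalCone ha)
    simp only [zero_apply, zero_add, sub_zero] at hm₀
    -- This multiple of `f` is normal to `C` at `a`, and its term in the supremum equals `m + 1`.
    have ht : 0 ≤ (m - xs a + 1) / (f x - f a) := div_nonneg (by linarith) hpos.le
    have := hm (a, ((m - xs a + 1) / (f x - f a)) • f) ⟨ha, fun c hc => by
      rw [smul_apply, smul_eq_mul, map_sub]
      exact mul_nonpos_of_nonneg_of_nonpos ht (by linarith [hmax c hc])⟩
    have heq : (m - xs a + 1) / (f x - f a) * (f x - f a) = m - xs a + 1 :=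
      div_mul_cancel₀ _ hpos.ne'
    simp only [smul_apply, smul_eq_mul] at this
    linarith

theorem pairing_le_fitzpatrick_normalCone (hX : IsReflexiveSpace X)
    (hCb : Bornology.IsBounded C) (hCcl : IsClosed C) (hCcv : Convex ℝ C) (hne : C.Nonempty)
    (p : X × StrongDual ℝ X) : ((p.2 p.1 : ℝ) : EReal) ≤ fitzpatrick (normalCone C) p := by
  rw [← Prod.mk.eta (p := p), fitzpatrick_normalCone hX hCb hCcl hCcv hne]
  by_cases hp : p.1 ∈ C
  · rw [indicatorFn_of_mem hp, zero_add]
    exact le_supportFn hp _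
  · rw [indicatorFn_of_notMem hp, EReal.top_add_of_ne_bot (supportFn_ne_bot hne _)]
    exact le_top

/-- When both base points lie in `C`, `xs p.1` is at most `σ_C(xs)` and `p.2 x` is absorbed by
`σ_C(p.2)`. The reverse bound holds for every monotone operator. -/
theorem pairConj_fitzpatrick_normalCone (hX : IsReflexiveSpace X) (hCb : Bornology.IsBounded C)
    (hCcl : IsClosed C) (hCcv : Convex ℝ C) (hne : C.Nonempty) (xs : StrongDual ℝ X) (x : X) :
    pairConj (fitzpatrick (normalCone C)) xs x = indicatorFn C x + supportFn C xs := by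
  apply le_antisymm
  · by_cases hx : x ∈ C
    · obtain ⟨s, hs⟩ := exists_supportFn_eq_coe hCb hne xs
      rw [indicatorFn_of_mem hx, zero_add, hs, pairConj_le_coe_iff]
      intro p r hr
      rw [← Prod.mk.eta (p := p), fitzpatrick_normalCone hX hCb hCcl hCcv hne] at hr
      by_cases hp : p.1 ∈ C
      · rw [indicatorFn_of_mem hp, zero_add, supportFn_le_coe_iff] at hr
        linarith [hr x hx, supportFn_le_coe_iff.1 hs.le p.1 hp]
      · rw [indicatorFn_of_notMem hp, EReal.top_add_of_ne_bot (supportFn_ne_bot hne _)] at hr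
        exact absurd (top_le_iff.1 hr) (EReal.coe_ne_top _)
    · rw [indicatorFn_of_notMem hx, EReal.top_add_of_ne_bot (supportFn_ne_bot hne _)]
      exact le_top
  · rw [← fitzpatrick_normalCone hX hCb hCcl hCcv hne]
    exact fitzpatrick_le_pairConj isMonotoneOp_normalCone x xs

end NormalCone

/-! ### Maximally monotone linear relations and Fenchel duality -/

section LinearRelation

variable {X : Type*} [NormedAddCommGroup X] [NormedSpace ℝ X]
  {A : X → Set (StrongDual ℝ X)} {C : Set X}

theorem IsLinearRel.zero_mem (hA : IsLinearRel A) : (0 : X × StrongDual ℝ X) ∈ gra A := by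
  obtain ⟨S, hS⟩ := hA
  exact hS ▸ S.zero_mem

theorem IsLinearRel.add_mem (hA : IsLinearRel A) {p q : X × StrongDual ℝ X} (hp : p ∈ gra A)
    (hq : q ∈ gra A) : p + q ∈ gra A := by
  obtain ⟨S, hS⟩ := hA
  rw [← hS] at hp hq ⊢
  exact S.add_mem hp hq

theorem IsLinearRel.smul_mem (hA : IsLinearRel A) (t : ℝ) {p : X × StrongDual ℝ X}
    (hp : p ∈ gra A) : t • p ∈ gra A := by
  obtain ⟨S, hS⟩ := hA
  rw [← hS] at hp ⊢
  exact S.smul_mem t hp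

theorem IsLinearRel.pairing_nonneg (hA : IsLinearRel A) (hAm : IsMonotoneOp A)
    {p : X × StrongDual ℝ X} (hp : p ∈ gra A) : 0 ≤ p.2 p.1 := by
  simpa using hAm p hp 0 hA.zero_mem

theorem exists_pair_vanishing_of_notMem_gra (hX : IsReflexiveSpace X) (hAmax : IsMaxMonotoneOp A)
    (hAlin : IsLinearRel A) {p : X × StrongDual ℝ X} (hp : p ∉ gra A) :
    ∃ (z : X) (zs : StrongDual ℝ X), (∀ a ∈ gra A, zs a.1 + a.2 z = 0) ∧ zs p.1 + p.2 z ≠ 0 := by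
  obtain ⟨S, hS⟩ := hAlin
  have hcl : IsClosed (S : Set (X × StrongDual ℝ X)) := hS ▸ isClosed_gra hAmax
  rw [← hS] at hp ⊢
  exact exists_pair_vanishing_of_notMem hX hcl hp

/-- The conjugate of the Fitzpatrick function is infinite off the graph. -/
theorem mem_gra_of_pairConj_le (hX : IsReflexiveSpace X) (hAmax : IsMaxMonotoneOp A)
    (hAlin : IsLinearRel A) {x : X} {xs : StrongDual ℝ X} {m : ℝ}
    (hm : pairConj (fitzpatrick A) xs x ≤ m) : (x, xs) ∈ gra A := by
  by_contra hp
  obtain ⟨z, zs, hz, hne⟩ := exists_pair_vanishing_of_notMem_gra hX hAmax hAlin hp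
  rw [pairConj_le_coe_iff] at hm
  set t := (m + 1) / (zs x + xs z) with ht
  -- Annihilation and `0 ≤ a.2 a.1` give `F_A ≤ 0` here, while the linear term equals `m + 1`.
  have h := hm (t • z, t • zs) 0 (by
    rw [fitzpatrick_le_coe_iff]
    intro a ha
    have h₁ : t * (zs a.1 + a.2 z) = 0 := by rw [hz a ha, mul_zero]
    have h₂ := hAlin.pairing_nonneg hAmax.1 ha
    simp only [map_smul, smul_apply, smul_eq_mul]
    linarith)
  have h₃ : t * (zs x + xs z) = m + 1 := div_mul_cancel₀ _ hne
  simp only [map_smul, smul_apply, smul_eq_mul] at h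
  linarith

theorem pairConj_fitzpatrick_of_mem (hAmax : IsMaxMonotoneOp A) {x : X} {xs : StrongDual ℝ X}
    (h : (x, xs) ∈ gra A) : pairConj (fitzpatrick A) xs x = ((xs x : ℝ) : EReal) := by
  apply le_antisymm
  · rw [pairConj_le_coe_iff]
    intro p r hr
    have := fitzpatrick_le_coe_iff.1 hr _ h
    simp only at this
    linarith
  · exact (pairing_le_fitzpatrick hAmax (x, xs)).trans (fitzpatrick_le_pairConj hAmax.1 x xs)

theorem pairConj_fitzpatrick_of_notMem (hX : IsReflexiveSpace X) (hAmax : IsMaxMonotoneOp A)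
    (hAlin : IsLinearRel A) {x : X} {xs : StrongDual ℝ X} (h : (x, xs) ∉ gra A) :
    pairConj (fitzpatrick A) xs x = ⊤ := by
  rw [EReal.eq_top_iff_forall_lt]
  by_contra! hm
  obtain ⟨m, hm⟩ := hm
  exact h (mem_gra_of_pairConj_le hX hAmax hAlin hm)

/-- A single-valued maximally monotone linear relation is densely defined. -/
theorem dual_eq_zero_of_vanishing_on_opDom (hAmax : IsMaxMonotoneOp A) (hAlin : IsLinearRel A)
    (hAsv : IsAtMostSingleValued A) {f : StrongDual ℝ X} (hf : ∀ x ∈ opDom A, f x = 0) :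
    f = 0 := by
  -- Vanishing on `dom A` makes `(0, f)` monotonically related to the graph, so `f` and 0 both lie
  -- in `A 0`.
  refine hAsv 0 (show (0, f) ∈ gra A from ?_) hAlin.zero_mem
  refine mem_gra_of_monotonically_related hAmax fun a ha => ?_
  have h₁ := hAlin.pairing_nonneg hAmax.1 ha
  have h₂ := hf a.1 ⟨a.2, ha⟩
  simp only [sub_apply, zero_sub, map_neg]
  linarith

theorem exists_mem_opDom_inter
    (hsub : IsClosedSubspace (⋃ (r : ℝ) (_ : 0 < r), r • (opDom A - C))) :
    ∃ c ∈ C, c ∈ opDom A := by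
  obtain ⟨-, S, hS⟩ := hsub
  have h : (0 : X) ∈ ⋃ (r : ℝ) (_ : 0 < r), r • (opDom A - C) := hS ▸ S.zero_mem
  simp only [Set.mem_iUnion] at h
  obtain ⟨r, hr, u, ⟨a, ha, c, hc, rfl⟩, hu⟩ := h
  have : a = c := sub_eq_zero.1 ((smul_eq_zero.1 hu).resolve_left hr.ne')
  exact ⟨c, hc, this ▸ ha⟩

/-- The constraint qualification says that `dom A - C` is absorbing. -/
theorem iUnion_smul_opDom_sub_eq_univ (hAmax : IsMaxMonotoneOp A) (hAlin : IsLinearRel A)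
    (hAsv : IsAtMostSingleValued A)
    (hsub : IsClosedSubspace (⋃ (r : ℝ) (_ : 0 < r), r • (opDom A - C))) :
    (⋃ (r : ℝ) (_ : 0 < r), r • (opDom A - C)) = Set.univ := by
  obtain ⟨c, hc, w, hw⟩ := exists_mem_opDom_inter hsub
  obtain ⟨hcl, S, hS⟩ := hsub
  rw [← hS] at hcl ⊢
  rw [Set.eq_univ_iff_forall]
  by_contra! hx
  obtain ⟨x, hx⟩ := hx
  obtain ⟨f, hf, hfx⟩ := exists_dual_vanishing_of_notMem hcl hx
  refine hfx ?_
  rw [dual_eq_zero_of_vanishing_on_opDom hAmax hAlin hAsv (f := f) ?_, zero_apply]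
  rintro a ⟨v, hv⟩
  apply hf
  rw [← SetLike.mem_coe, hS]
  simp only [Set.mem_iUnion]
  exact ⟨1, one_pos, a, ⟨a + c, ⟨v + w, hAlin.add_mem (p := (a, v)) (q := (c, w)) hv hw⟩, c, hc,
    add_sub_cancel_right a c⟩, one_smul ℝ a⟩

/-- The part of `dom A - C` where `A` takes values of norm at most `r`. -/
def boundedDiff (A : X → Set (StrongDual ℝ X)) (C : Set X) (r : ℝ) : Set X :=
  {u | ∃ y ∈ C, ∃ w : StrongDual ℝ X, ‖w‖ ≤ r ∧ (y + u, w) ∈ gra A}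

theorem boundedDiff_mono {r s : ℝ} (h : r ≤ s) : boundedDiff A C r ⊆ boundedDiff A C s :=
  fun _ ⟨y, hy, w, hw, hyw⟩ => ⟨y, hy, w, hw.trans h, hyw⟩

theorem convex_boundedDiff (hAlin : IsLinearRel A) (hCcv : Convex ℝ C) (r : ℝ) :
    Convex ℝ (boundedDiff A C r) := by
  rintro u ⟨y, hy, w, hw, hyw⟩ u' ⟨y', hy', w', hw', hyw'⟩ s t hs ht hst
  have hball := convex_closedBall (0 : StrongDual ℝ X) r (mem_closedBall_zero_iff.2 hw)
    (mem_closedBall_zero_iff.2 hw') hs ht hst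
  refine ⟨s • y + t • y', hCcv hy hy' hs ht hst, s • w + t • w',
    mem_closedBall_zero_iff.1 hball, ?_⟩
  have := hAlin.add_mem (hAlin.smul_mem s hyw) (hAlin.smul_mem t hyw')
  convert this using 1
  ext1
  · simp only [Prod.smul_mk, Prod.mk_add_mk]
    module
  · rfl

/-- The witnesses in `C` and in the dual ball converge only weakly and weak-*. That suffices,
because the graph is cut out by functionals `(zs, z)`, which pass to such limits. -/
theorem isClosed_boundedDiff (hX : IsReflexiveSpace X) (hAmax : IsMaxMonotoneOp A)
    (hAlin : IsLinearRel A) (hCb : Bornology.IsBounded C) (hCcl : IsClosed C)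
    (hCcv : Convex ℝ C) (r : ℝ) : IsClosed (boundedDiff A C r) := by
  refine IsSeqClosed.isClosed fun u u₀ hu hlim => ?_
  choose y hy w hw hyw using hu
  let U : Ultrafilter ℕ := hyperfilter ℕ
  have hlimU : Tendsto u U (𝓝 u₀) := hlim.mono_left Nat.hyperfilter_le_atTop
  obtain ⟨y₀, hy₀, hylim⟩ := exists_weak_ultrafilter_limit hX hCb hCcl hCcv U hy
  obtain ⟨w₀, hw₀, hwlim⟩ := exists_dual_ultrafilter_limit U hw
  refine ⟨y₀, hy₀, w₀, hw₀, ?_⟩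
  by_contra hp
  obtain ⟨z, zs, hz, hne⟩ := exists_pair_vanishing_of_notMem_gra hX hAmax hAlin hp
  refine hne (tendsto_nhds_unique (f := fun n => zs (y n + u n) + w n z) (l := (U : Filter ℕ))
    ?_ ?_)
  · simp only [map_add]
    exact ((hylim zs).add ((zs.continuous.tendsto u₀).comp hlimU)).add (hwlim z)
  · simp only [hz _ (hyw _)]
    exact tendsto_const_nhds

/-- The Robinson-Ursescu step: the absorbing set `dom A - C` contains a ball on which the values
of `A` can be chosen uniformly bounded. -/
theorem exists_ball_subset_boundedDiff [CompleteSpace X] (hX : IsReflexiveSpace X)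
    (hAmax : IsMaxMonotoneOp A) (hAlin : IsLinearRel A) (hCb : Bornology.IsBounded C)
    (hCcl : IsClosed C) (hCcv : Convex ℝ C)
    (huniv : (⋃ (r : ℝ) (_ : 0 < r), r • (opDom A - C)) = Set.univ) :
    ∃ r : ℝ, ∃ δ > 0, Metric.ball 0 δ ⊆ boundedDiff A C r := by
  have hrep : ∀ x : X, ∃ t : ℝ, 0 < t ∧ ∃ n : ℕ, ∃ u ∈ boundedDiff A C n, t • u = x := by
    intro x
    have hx : x ∈ ⋃ (r : ℝ) (_ : 0 < r), r • (opDom A - C) := huniv ▸ Set.mem_univ x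
    simp only [Set.mem_iUnion] at hx
    obtain ⟨t, ht, u, ⟨a, ⟨w, hw⟩, c, hc, rfl⟩, rfl⟩ := hx
    obtain ⟨n, hn⟩ := exists_nat_ge ‖w‖
    refine ⟨t, ht, n, a - c, ⟨c, hc, w, hn, ?_⟩, rfl⟩
    rw [add_sub_cancel]
    exact hw
  obtain ⟨n₀, h₀⟩ : ∃ n : ℕ, (0 : X) ∈ boundedDiff A C n := by
    obtain ⟨t, ht, n, u, hu, h⟩ := hrep 0
    exact ⟨n, (smul_eq_zero.1 h).resolve_left ht.ne' ▸ hu⟩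
  have hcover : ⋃ i : ℕ × ℕ, ((i.1 : ℝ) + 1) • boundedDiff A C i.2 = Set.univ := by
    rw [Set.eq_univ_iff_forall]
    intro x
    obtain ⟨t, ht, n, u, hu, rfl⟩ := hrep x
    obtain ⟨k, hk⟩ := exists_nat_ge t
    have hk₀ : (0 : ℝ) < k + 1 := by positivity
    -- The level `n₀` puts 0 in the set, so convexity allows shrinking `u` by a factor at most 1.
    refine Set.mem_iUnion.2 ⟨(k, max n n₀), (t / (k + 1)) • u, ?_, ?_⟩
    · have hcv := convex_boundedDiff (A := A) hAlin hCcv ((max n n₀ : ℕ) : ℝ)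
      exact hcv.smul_mem_of_zero_mem
        (boundedDiff_mono (Nat.cast_le.2 (le_max_right n n₀)) h₀)
        (boundedDiff_mono (Nat.cast_le.2 (le_max_left n n₀)) hu)
        ⟨by positivity, (div_le_one hk₀).2 (by linarith)⟩
    · simp only [smul_smul, mul_div_cancel₀ _ hk₀.ne']
  obtain ⟨⟨k, n⟩, u₀, hu₀⟩ := nonempty_interior_of_iUnion_of_closed (fun i : ℕ × ℕ =>
    (isClosed_boundedDiff hX hAmax hAlin hCb hCcl hCcv i.2).smul₀ ((i.1 : ℝ) + 1)) hcover
  rw [interior_smul₀ (by positivity)] at hu₀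
  obtain ⟨u₁, hu₁, -⟩ := hu₀
  -- Baire yields an interior point `u₁`, perhaps not 0. Absorbing `-u₁` places 0 strictly between
  -- `u₁` and a point `v` of the set.
  obtain ⟨t, ht, m, v, hv, hvu⟩ := hrep (-u₁)
  have hint : u₁ ∈ interior (boundedDiff A C ((max n m : ℕ) : ℝ)) :=
    interior_mono (boundedDiff_mono (Nat.cast_le.2 (le_max_left n m))) hu₁
  have hmem : v ∈ boundedDiff A C ((max n m : ℕ) : ℝ) :=
    boundedDiff_mono (Nat.cast_le.2 (le_max_right n m)) hv
  have hzero := (convex_boundedDiff hAlin hCcv _).combo_interior_self_mem_interior hint hmem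
    (a := 1 / (1 + t)) (b := t / (1 + t)) (by positivity) (by positivity) (by field_simp)
  have heq : (1 / (1 + t)) • u₁ + (t / (1 + t)) • v = 0 := by
    rw [div_eq_mul_one_div t, mul_comm, mul_smul, hvu, smul_neg, add_neg_cancel]
  rw [heq, mem_interior_iff_mem_nhds, Metric.mem_nhds_iff] at hzero
  obtain ⟨δ, hδ, hball⟩ := hzero
  exact ⟨_, δ, hδ, hball⟩

/-- Fenchel duality for the conjugate of `F_A + ι_{C × X^*}`: the infimal convolution of the
conjugates is exact. -/
theorem exists_mem_gra_of_conj_restrict_le [CompleteSpace X] (hX : IsReflexiveSpace X)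
    (hAmax : IsMaxMonotoneOp A) (hAlin : IsLinearRel A) (hCb : Bornology.IsBounded C)
    (hCcl : IsClosed C) (hCcv : Convex ℝ C)
    (huniv : (⋃ (r : ℝ) (_ : 0 < r), r • (opDom A - C)) = Set.univ)
    (hne : ∃ c ∈ C, c ∈ opDom A) {x : X} {xs : StrongDual ℝ X} {m : ℝ}
    (hm : ∀ y ∈ C, ∀ (w : StrongDual ℝ X) (r : ℝ), fitzpatrick A (y, w) ≤ r →
      xs y + w x - r ≤ m) :
    ∃ v ∈ A x, ∀ c ∈ C, v x + (xs - v) c ≤ m := by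
  -- Essentially the epigraph of the value function `u ↦ inf (F_A(y + u, w) - w x - xs y)` over `y ∈
  -- C` and `w`; its value at 0 is at least `-m`.
  let E : Set (X × ℝ) := {p | ∃ y ∈ C, ∃ w : StrongDual ℝ X,
    fitzpatrick A (y + p.1, w) ≤ ((p.2 + w x + xs y : ℝ) : EReal)}
  have hE : Convex ℝ E := by
    rintro p ⟨y, hy, w, hw⟩ p' ⟨y', hy', w', hw'⟩ s t hs ht hst
    refine ⟨s • y + t • y', hCcv hy hy' hs ht hst, s • w + t • w', ?_⟩
    have h := isConvexFn_fitzpatrick (A := A) (x := ((y + p.1, w), p.2 + w x + xs y)) hw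
      (y := ((y' + p'.1, w'), p'.2 + w' x + xs y')) hw' hs ht hst
    simp only [Set.mem_ofPred_eq] at h
    convert h using 2
    · ext1
      · simp only [Prod.fst_add, Prod.smul_fst]
        module
      · rfl
    · simp only [Prod.snd_add, Prod.smul_snd, map_add, map_smul, add_apply, smul_apply,
        smul_eq_mul]
      ring
  obtain ⟨N, δ, hδ, hball⟩ :=
    exists_ball_subset_boundedDiff hX hAmax hAlin hCb hCcl hCcv huniv
  obtain ⟨M, hM⟩ := hCb.exists_norm_le
  obtain ⟨R, hR⟩ : ∃ R : ℝ, ∀ u ∈ Metric.ball (0 : X) δ, ∀ r : ℝ, R ≤ r → (u, r) ∈ E := by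
    refine ⟨N * (M + δ) + N * ‖x‖ + ‖xs‖ * M, fun u hu r hr => ?_⟩
    obtain ⟨y, hy, w, hw, hyw⟩ := hball hu
    refine ⟨y, hy, w, (fitzpatrick_le_pairing hAmax.1 hyw).trans (EReal.coe_le_coe_iff.2 ?_)⟩
    have hN : 0 ≤ N := (norm_nonneg w).trans hw
    have hu' : ‖u‖ ≤ δ := (mem_ball_zero_iff.1 hu).le
    have h₁ : w (y + u) ≤ N * (M + δ) := by
      refine (le_abs_self _).trans ((w.le_opNorm _).trans ?_)
      exact mul_le_mul hw ((norm_add_le y u).trans (add_le_add (hM y hy) hu'))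
        (norm_nonneg _) hN
    have h₂ : -(w x) ≤ N * ‖x‖ :=
      (neg_le_abs _).trans ((w.le_opNorm x).trans
        (mul_le_mul_of_nonneg_right hw (norm_nonneg _)))
    have h₃ : -(xs y) ≤ ‖xs‖ * M :=
      (neg_le_abs _).trans ((xs.le_opNorm y).trans
        (mul_le_mul_of_nonneg_left (hM y hy) (norm_nonneg _)))
    simp only
    linarith
  have hlow : ∀ r : ℝ, ((0 : X), r) ∈ E → -m ≤ r := by
    rintro r ⟨y, hy, w, hw⟩
    simp only [add_zero] at hw
    linarith [hm y hy w _ hw]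
  have hRm : -m ≤ R := hlow R (hR 0 (Metric.mem_ball_self hδ) R le_rfl)
  have hint : ((0 : X), R + 1) ∈ interior E := by
    rw [mem_interior_iff_mem_nhds]
    refine Filter.mem_of_superset (prod_mem_nhds (Metric.ball_mem_nhds 0 hδ)
      (Ioi_mem_nhds (lt_add_one R))) ?_
    rintro ⟨u, r⟩ ⟨hu, hr⟩
    exact hR u hu r (le_of_lt hr)
  have hnot : ((0 : X), -m) ∉ interior E := by
    intro h
    have hcont : Tendsto (fun ε : ℝ => ((0 : X), -m - ε)) (𝓝[>] 0) (𝓝 ((0 : X), -m)) := by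
      have : Continuous fun ε : ℝ => ((0 : X), -m - ε) := by fun_prop
      simpa using (this.tendsto 0).mono_left nhdsWithin_le_nhds
    obtain ⟨ε, hε, hpos⟩ := ((hcont.eventually (mem_interior_iff_mem_nhds.1 h)).and
      self_mem_nhdsWithin).exists
    have := hlow _ hε
    have : 0 < ε := hpos
    linarith
  obtain ⟨f, hf⟩ := geometric_hahn_banach_open_point hE.interior isOpen_interior hnot
  -- A convex set with nonempty interior lies in the closure of that interior.
  have hfE : ∀ p ∈ E, f p ≤ f ((0 : X), -m) := by
    intro p hp
    have hcl : p ∈ closure (interior E) := by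
      rw [hE.closure_interior_eq_closure_of_nonempty_interior ⟨_, hint⟩]
      exact subset_closure hp
    exact closure_minimal (fun q hq => (hf q hq).le) (isClosed_le f.continuous continuous_const)
      hcl
  let g : StrongDual ℝ X := f.comp (ContinuousLinearMap.inl ℝ X ℝ)
  have hfg : ∀ (u : X) (r : ℝ), f (u, r) = g u + r * f (0, 1) := by
    intro u r
    have : (u, r) = ContinuousLinearMap.inl ℝ X ℝ u + r • ((0 : X), (1 : ℝ)) := by
      ext1 <;> simp
    rw [this, map_add, map_smul, smul_eq_mul]
    rfl
  have hκ : f (0, 1) < 0 := by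
    have := hf _ hint
    rw [hfg 0 (R + 1), hfg 0 (-m)] at this
    by_contra! h
    have := mul_le_mul_of_nonneg_right (show -m ≤ R + 1 by linarith) h
    linarith
  set κ := -f (0, 1) with hκdef
  have hκ' : 0 < κ := by linarith
  let v : StrongDual ℝ X := κ⁻¹ • g
  have hv : ∀ p ∈ E, v p.1 ≤ p.2 + m := by
    rintro ⟨u, r⟩ hp
    have h := hfE _ hp
    rw [hfg u r, hfg 0 (-m), map_zero, show f (0, 1) = -κ by rw [hκdef, neg_neg]] at h
    change κ⁻¹ * g u ≤ r + m
    rw [inv_mul_le_iff₀ hκ']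
    linarith
  -- Taking `u = z - y` in `hv` decouples the variables: the left side involves only `F_A`, the
  -- right side only `C`. Fixing `y` bounds `F_A^*` at `(v, x)` and so forces `v ∈ A x`.
  have hsep : ∀ y ∈ C, ∀ (z : X) (w : StrongDual ℝ X) (r : ℝ), fitzpatrick A (z, w) ≤ r →
      v z + w x - r ≤ m - (xs - v) y := by
    intro y hy z w r hr
    have h := hv (z - y, r - w x - xs y) ⟨y, hy, w, by
      have hr' : r - w x - xs y + w x + xs y = r := by ring
      simpa only [add_sub_cancel, hr'] using hr⟩
    simp only [map_sub, sub_apply] at h ⊢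
    linarith
  obtain ⟨c, hc, -⟩ := hne
  have hmem : (x, v) ∈ gra A :=
    mem_gra_of_pairConj_le hX hAmax hAlin (pairConj_le_coe_iff.2 fun p r hr =>
      hsep c hc p.1 p.2 r hr)
  refine ⟨v, hmem, fun y hy => ?_⟩
  have := hsep y hy x v (v x) (fitzpatrick_le_pairing hAmax.1 hmem)
  linarith

end LinearRelation

/-! ### The conjugate of the partial inf-convolution -/

section PartialInfConv

variable {X : Type*} [NormedAddCommGroup X] [NormedSpace ℝ X]
  {A : X → Set (StrongDual ℝ X)} {C : Set X}

theorem fitzpatrick_normalCone_le_coe_iff (hX : IsReflexiveSpace X)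
    (hCb : Bornology.IsBounded C) (hCcl : IsClosed C) (hCcv : Convex ℝ C) (hne : C.Nonempty)
    {x : X} {xs : StrongDual ℝ X} {r : ℝ} :
    fitzpatrick (normalCone C) (x, xs) ≤ r ↔ x ∈ C ∧ ∀ c ∈ C, xs c ≤ r := by
  rw [fitzpatrick_normalCone hX hCb hCcl hCcv hne]
  by_cases hx : x ∈ C
  · rw [indicatorFn_of_mem hx, zero_add, supportFn_le_coe_iff, and_iff_right hx]
  · rw [indicatorFn_of_notMem hx, EReal.top_add_of_ne_bot (supportFn_ne_bot hne _)]
    simp [hx]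

/-- A finite value of the conjugate of `F_A □₂ F_{N_C}` at `(x^*, x)` forces `x ∈ C ∩ dom A`. -/
theorem exists_mem_of_pairConj_partialInfConv_le [CompleteSpace X] (hX : IsReflexiveSpace X)
    (hAmax : IsMaxMonotoneOp A) (hAlin : IsLinearRel A) (hAsv : IsAtMostSingleValued A)
    (hCb : Bornology.IsBounded C) (hCcl : IsClosed C) (hCcv : Convex ℝ C)
    (hsub : IsClosedSubspace (⋃ (r : ℝ) (_ : 0 < r), r • (opDom A - C)))
    {x : X} {xs : StrongDual ℝ X} {m : ℝ}
    (hm : pairConj (partialInfConv (fitzpatrick A) (fitzpatrick (normalCone C))) xs x ≤ m) :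
    x ∈ C ∧ ∃ v ∈ A x, ∀ c ∈ C, v x + (xs - v) c ≤ m := by
  obtain ⟨c₀, hc₀, a₀, ha₀⟩ := exists_mem_opDom_inter hsub
  rw [pairConj_le_coe_iff] at hm
  have key : ∀ y ∈ C, ∀ (w v : StrongDual ℝ X) (r s : ℝ), fitzpatrick A (y, w) ≤ r →
      (∀ c ∈ C, v c ≤ s) → xs y + w x + v x - (r + s) ≤ m := by
    intro y hy w v r s hr hs
    have h := hm (y, w + v) (r + s) ((iInf_le _ v).trans (by
      rw [EReal.coe_add, add_sub_cancel_right]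
      exact add_le_add hr ((fitzpatrick_normalCone_le_coe_iff hX hCb hCcl hCcv ⟨c₀, hc₀⟩).2
        ⟨hy, hs⟩)))
    simp only [add_apply] at h
    linarith
  constructor
  · by_contra hx
    obtain ⟨f, u, hf, hu⟩ := geometric_hahn_banach_closed_point hCcv hCcl hx
    have hF := fitzpatrick_le_pairing hAmax.1 (p := (c₀, a₀)) ha₀
    have hpos : 0 < f x - u := by linarith
    have h₀ := key c₀ hc₀ a₀ 0 _ 0 hF fun c _ => by simp
    simp only [zero_apply, add_zero] at h₀
    set t := (m - (xs c₀ + a₀ x - a₀ c₀) + 1) / (f x - u) with ht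
    have ht₀ : 0 ≤ t := div_nonneg (by linarith) hpos.le
    have h := key c₀ hc₀ a₀ (t • f) _ (t * u) hF fun c hc => by
      rw [smul_apply, smul_eq_mul]
      exact mul_le_mul_of_nonneg_left (hf c hc).le ht₀
    have heq : t * (f x - u) = m - (xs c₀ + a₀ x - a₀ c₀) + 1 := div_mul_cancel₀ _ hpos.ne'
    simp only [smul_apply, smul_eq_mul] at h
    linarith
  -- The choice `v = 0` in `key` leaves the conjugate of `F_A + ι_{C × X^*}`.
  · refine exists_mem_gra_of_conj_restrict_le hX hAmax hAlin hCb hCcl hCcv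
      (iUnion_smul_opDom_sub_eq_univ hAmax hAlin hAsv hsub) ⟨c₀, hc₀, a₀, ha₀⟩ ?_
    intro y hy w r hr
    have := key y hy w 0 r 0 hr fun c _ => by simp
    simp only [zero_apply, add_zero] at this
    exact this

theorem pairConj_partialInfConv_of_mem [CompleteSpace X] (hX : IsReflexiveSpace X)
    (hAmax : IsMaxMonotoneOp A) (hAlin : IsLinearRel A) (hAsv : IsAtMostSingleValued A)
    (hCb : Bornology.IsBounded C) (hCcl : IsClosed C) (hCcv : Convex ℝ C)
    (hsub : IsClosedSubspace (⋃ (r : ℝ) (_ : 0 < r), r • (opDom A - C)))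
    {x : X} (xs : StrongDual ℝ X) {v : StrongDual ℝ X} (hv : v ∈ A x) (hx : x ∈ C) :
    pairConj (partialInfConv (fitzpatrick A) (fitzpatrick (normalCone C))) xs x =
      ((v x : ℝ) : EReal) + supportFn C (xs - v) := by
  obtain ⟨s, hs⟩ := exists_supportFn_eq_coe hCb ⟨x, hx⟩ (xs - v)
  have hsC := supportFn_le_coe_iff.1 hs.le
  rw [hs, ← EReal.coe_add]
  apply le_antisymm
  · rw [pairConj_eq]
    refine iSup_le fun p => ?_
    have hG : ((xs p.1 + p.2 x - (v x + s) : ℝ) : EReal) ≤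
        partialInfConv (fitzpatrick A) (fitzpatrick (normalCone C)) p := by
      refine le_iInf fun w => ?_
      have hF := le_fitzpatrick (A := A) (a := (x, v)) hv (p.1, p.2 - w)
      rw [fitzpatrick_normalCone hX hCb hCcl hCcv ⟨x, hx⟩]
      by_cases hp : p.1 ∈ C
      · rw [indicatorFn_of_mem hp, zero_add]
        refine le_trans ?_ (add_le_add hF (le_supportFn hx w))
        rw [← EReal.coe_add, EReal.coe_le_coe_iff]
        have := hsC p.1 hp
        simp only [sub_apply] at this ⊢
        linarith
      · rw [indicatorFn_of_notMem hp, EReal.top_add_of_ne_bot (supportFn_ne_bot ⟨x, hx⟩ _),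
          EReal.add_top_of_ne_bot (ne_bot_of_le_ne_bot (EReal.coe_ne_bot _) hF)]
        exact le_top
    rw [coe_sub_le_coe_iff]
    intro r hr
    have := EReal.coe_le_coe_iff.1 (hG.trans hr)
    linarith
  · rw [← EReal.le_of_forall_lt_iff_le]
    intro m hm
    obtain ⟨-, v', hv', h⟩ := exists_mem_of_pairConj_partialInfConv_le hX hAmax hAlin hAsv hCb
      hCcl hCcv hsub hm.le
    obtain rfl := hAsv x hv hv'
    have hsup : supportFn C (xs - v) ≤ ((m - v x : ℝ) : EReal) :=
      supportFn_le_coe_iff.2 fun c hc => by linarith [h c hc]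
    rw [hs, EReal.coe_le_coe_iff] at hsup
    exact EReal.coe_le_coe_iff.2 (by linarith)

theorem pairConj_partialInfConv_of_notMem [CompleteSpace X] (hX : IsReflexiveSpace X)
    (hAmax : IsMaxMonotoneOp A) (hAlin : IsLinearRel A) (hAsv : IsAtMostSingleValued A)
    (hCb : Bornology.IsBounded C) (hCcl : IsClosed C) (hCcv : Convex ℝ C)
    (hsub : IsClosedSubspace (⋃ (r : ℝ) (_ : 0 < r), r • (opDom A - C)))
    {x : X} (xs : StrongDual ℝ X) (hx : x ∉ C ∩ opDom A) :
    pairConj (partialInfConv (fitzpatrick A) (fitzpatrick (normalCone C))) xs x = ⊤ := by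
  rw [EReal.eq_top_iff_forall_lt]
  by_contra! h
  obtain ⟨m, hm⟩ := h
  obtain ⟨hxC, v, hv, -⟩ := exists_mem_of_pairConj_partialInfConv_le hX hAmax hAlin hAsv hCb
    hCcl hCcv hsub hm
  exact hx ⟨hxC, v, hv⟩

theorem pairConj_add_pairConj (hX : IsReflexiveSpace X) (hAmax : IsMaxMonotoneOp A)
    (hAlin : IsLinearRel A) (hCb : Bornology.IsBounded C) (hCcl : IsClosed C)
    (hCcv : Convex ℝ C) (hne : C.Nonempty) (x : X) (xs ys : StrongDual ℝ X) :
    pairConj (fitzpatrick A) xs x + pairConj (fitzpatrick (normalCone C)) (ys - xs) x =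
      indicatorFn (gra A ∩ C ×ˢ Set.univ) (x, xs) + ((xs x : ℝ) : EReal)
        + supportFn C (ys - xs) := by
  rw [pairConj_fitzpatrick_normalCone hX hCb hCcl hCcv hne]
  obtain ⟨s, hs⟩ := exists_supportFn_eq_coe hCb hne (ys - xs)
  rw [hs]
  by_cases hA : (x, xs) ∈ gra A
  · rw [pairConj_fitzpatrick_of_mem hAmax hA]
    by_cases hx : x ∈ C
    · rw [indicatorFn_of_mem hx,
        indicatorFn_of_mem (S := gra A ∩ C ×ˢ Set.univ) ⟨hA, hx, Set.mem_univ _⟩,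
        zero_add, zero_add]
    · rw [indicatorFn_of_notMem hx,
        indicatorFn_of_notMem (S := gra A ∩ C ×ˢ Set.univ) fun h => hx h.2.1, EReal.top_add_coe,
        EReal.coe_add_top, EReal.top_add_coe, EReal.top_add_coe]
  · rw [pairConj_fitzpatrick_of_notMem hX hAmax hAlin hA,
      indicatorFn_of_notMem (S := gra A ∩ C ×ˢ Set.univ) fun h => hA h.1,
      EReal.top_add_coe, EReal.top_add_coe]
    refine EReal.top_add_of_ne_bot ?_
    by_cases hx : x ∈ C
    · rw [indicatorFn_of_mem hx, zero_add]
      exact EReal.coe_ne_bot s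
    · rw [indicatorFn_of_notMem hx, EReal.top_add_coe]
      exact top_ne_bot

theorem exists_supportFn_pos (hne : C.Nonempty) (hC0 : C ≠ {0}) :
    ∃ f : StrongDual ℝ X, 0 < supportFn C f := by
  obtain ⟨c, hc, hc0⟩ : ∃ c ∈ C, c ≠ 0 := by
    by_contra! h
    exact hC0 (hne.subset_singleton_iff.1 h)
  obtain ⟨f, hf⟩ := geometric_hahn_banach_point_point (E := X) hc0.symm
  rw [map_zero] at hf
  exact ⟨f, lt_of_lt_of_le (EReal.coe_lt_coe_iff.2 hf) (le_supportFn hc f)⟩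

/-- The left side is finite. For `xs ≠ v` the right side is `⊤`; for `xs = v` the support terms are
`σ_C(0) ≤ 0` on the left and `σ_C(zs - v) > 0` on the right. -/
theorem pairConj_partialInfConv_lt [CompleteSpace X] (hX : IsReflexiveSpace X)
    (hAmax : IsMaxMonotoneOp A) (hAlin : IsLinearRel A) (hAsv : IsAtMostSingleValued A)
    (hCb : Bornology.IsBounded C) (hCcl : IsClosed C) (hCcv : Convex ℝ C)
    (hsub : IsClosedSubspace (⋃ (r : ℝ) (_ : 0 < r), r • (opDom A - C)))
    {z : X} {zs v : StrongDual ℝ X} (hz : z ∈ C) (hv : v ∈ A z)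
    (hpos : 0 < supportFn C (zs - v)) (xs : StrongDual ℝ X) :
    pairConj (partialInfConv (fitzpatrick A) (fitzpatrick (normalCone C))) xs z <
      pairConj (fitzpatrick A) xs z
        + pairConj (fitzpatrick (normalCone C)) (zs - xs) z := by
  have hne : C.Nonempty := ⟨z, hz⟩
  rw [pairConj_partialInfConv_of_mem hX hAmax hAlin hAsv hCb hCcl hCcv hsub xs hv hz,
    pairConj_add_pairConj hX hAmax hAlin hCb hCcl hCcv hne]
  obtain ⟨s, hs⟩ := exists_supportFn_eq_coe hCb hne (xs - v)
  obtain ⟨s', hs'⟩ := exists_supportFn_eq_coe hCb hne (zs - xs)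
  rw [hs, hs', ← EReal.coe_add]
  by_cases hxs : xs = v
  · subst hxs
    rw [indicatorFn_of_mem (S := gra A ∩ C ×ˢ Set.univ) ⟨hv, hz, Set.mem_univ _⟩, zero_add,
      ← EReal.coe_add, EReal.coe_lt_coe_iff]
    have h₀ : s ≤ 0 := by
      rw [← EReal.coe_le_coe_iff, ← hs, sub_self, supportFn_le_coe_iff]
      simp
    rw [hs', EReal.coe_pos] at hpos
    linarith
  · rw [indicatorFn_of_notMem (S := gra A ∩ C ×ˢ Set.univ) fun h => hxs (hAsv z h.1 hv),
      EReal.top_add_coe, EReal.top_add_coe]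
    exact EReal.coe_lt_top _

end PartialInfConv

/-! ### The norm estimate on the unit ball -/

section UnitBall

theorem HasHilbertNorm.strictConvexSpace {X : Type*} [NormedAddCommGroup X]
    [inst : NormedSpace ℝ X] (h : HasHilbertNorm X) : StrictConvexSpace ℝ X := by
  obtain ⟨ip, rfl⟩ := h
  infer_instance

variable {X : Type*} [NormedAddCommGroup X] [NormedSpace ℝ X]

/-- If `ys ≠ 0`, `heq` and `hys` give `‖x‖ ≥ 1 + ‖x - y‖`, so the triangle inequality is an equality
and `‖y‖ = 1`. Strict convexity makes `x` a positive multiple of `y`, whence `xs y ≥ 0`, and `xs +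
ys` is evaluated at `y`. -/
theorem norm_le_norm_add_of_norming [StrictConvexSpace ℝ X] {x y : X} {xs ys : StrongDual ℝ X}
    (hx : 0 ≤ xs x) (hy : ‖y‖ ≤ 1) (hys : ‖ys‖ ≤ ys y)
    (heq : ys (x - y) = ‖x - y‖ * ‖ys‖) : ‖ys‖ ≤ ‖xs + ys‖ := by
  rcases (norm_nonneg ys).eq_or_lt with h0 | hpos
  · exact h0 ▸ norm_nonneg _
  have hle : ‖x - y‖ + 1 ≤ ‖x‖ := by
    have h₁ := (le_abs_self _).trans (ys.le_opNorm x)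
    rw [map_sub] at heq
    refine le_of_mul_le_mul_left ?_ hpos
    linarith
  have htri : ‖y + (x - y)‖ ≤ ‖y‖ + ‖x - y‖ := norm_add_le _ _
  rw [add_sub_cancel] at htri
  have hy₁ : ‖y‖ = 1 := by linarith
  have hray : SameRay ℝ y (x - y) :=
    sameRay_iff_norm_add.2 (by rw [add_sub_cancel]; linarith)
  obtain ⟨r, hr, hrx⟩ := hray.exists_nonneg_left (norm_pos_iff.1 (by linarith))
  have hxy : x = (1 + r) • y := by rw [add_smul, one_smul, hrx, add_sub_cancel]
  rw [hxy, map_smul, smul_eq_mul] at hx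
  have hxs : 0 ≤ xs y := nonneg_of_mul_nonneg_right hx (by linarith)
  have h := (le_abs_self _).trans ((xs + ys).le_opNorm y)
  rw [hy₁, mul_one, add_apply] at h
  linarith

theorem norm_le_of_forall_closedBall_le {f : StrongDual ℝ X} {s : ℝ}
    (h : ∀ c ∈ Metric.closedBall (0 : X) 1, f c ≤ s) : ‖f‖ ≤ s := by
  have hs : 0 ≤ s := by simpa using h 0 (by simp)
  refine f.opNorm_le_of_unit_norm hs fun x hx => ?_
  rw [Real.norm_eq_abs, abs_le']
  refine ⟨h x (by simp [hx]), ?_⟩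
  have := h (-x) (by simp [hx])
  rwa [map_neg] at this

end UnitBall

end BCFunctions

theorem theorem4p3 {X : Type*} [NormedAddCommGroup X] [NormedSpace ℝ X] [CompleteSpace X]
    (hX : IsReflexiveSpace X)
    (A : X → Set (StrongDual ℝ X)) (hAmax : IsMaxMonotoneOp A) (hAlin : IsLinearRel A)
    (hAsv : IsAtMostSingleValued A)
    (C : Set X) (hC0 : C ≠ {0}) (hCb : Bornology.IsBounded C) (hCcl : IsClosed C)
    (hCcv : Convex ℝ C)
    (hsub : IsClosedSubspace (⋃ (r : ℝ) (_ : 0 < r), r • (opDom A - C)))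
    (j : ℝ≥0 → ℝ≥0) (hj : Monotone j) (hjge : ∀ γ, γ ≤ j γ) :
    -- (i)
    (IsBC (fitzpatrick A) ∧
      (∀ (x : X) (xs : StrongDual ℝ X),
        fitzpatrick (normalCone C) (x, xs) = indicatorFn C x + supportFn C xs) ∧
      IsBC (fitzpatrick (normalCone C))) ∧
    -- (ii)
    (∀ (x : X) (xs ys : StrongDual ℝ X),
      pairConj (fitzpatrick A) xs x + pairConj (fitzpatrick (normalCone C)) (ys - xs) x =
        indicatorFn (gra A ∩ C ×ˢ Set.univ) (x, xs) + ((xs x : ℝ) : EReal)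
          + supportFn C (ys - xs)) ∧
    -- (iii)
    (∀ (x : X) (xs : StrongDual ℝ X),
      (∀ Ax ∈ A x, x ∈ C →
        pairConj (partialInfConv (fitzpatrick A) (fitzpatrick (normalCone C))) xs x =
          ((Ax x : ℝ) : EReal) + supportFn C (xs - Ax)) ∧
      (x ∉ C ∩ opDom A →
        pairConj (partialInfConv (fitzpatrick A) (fitzpatrick (normalCone C))) xs x = ⊤)) ∧
    -- (iv)
    (∃ (z : X) (zs : StrongDual ℝ X), z ∈ C ∧ ∃ Az ∈ A z, 0 < supportFn C (zs - Az)) ∧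
    -- (v)
    (∀ (z : X) (zs : StrongDual ℝ X), z ∈ C → ∀ Az ∈ A z, 0 < supportFn C (zs - Az) →
      ∀ xs : StrongDual ℝ X,
        pairConj (partialInfConv (fitzpatrick A) (fitzpatrick (normalCone C))) xs z <
          pairConj (fitzpatrick A) xs z
            + pairConj (fitzpatrick (normalCone C)) (zs - xs) z) ∧
    -- (vi)
    (HasHilbertNorm X → C = Metric.closedBall 0 1 →
      ∀ (x y : X) (xs ys : StrongDual ℝ X),
        (x, xs) ∈ posSet (fitzpatrick A) → (y, ys) ∈ posSet (fitzpatrick (normalCone C)) →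
        x ≠ y → ys (x - y) = ‖x - y‖ * ‖ys‖ →
        ‖ys‖₊ ≤ ‖xs + ys‖₊ ∧
          ‖xs + ys‖₊ ≤ j (‖x‖₊ + ‖xs + ys‖₊ + ‖y‖₊ + ‖x - y‖₊ * ‖ys‖₊)) := by
  obtain ⟨c, hc, a, ha⟩ := exists_mem_opDom_inter hsub
  have hne : C.Nonempty := ⟨c, hc⟩
  refine ⟨⟨isBC_fitzpatrick hAmax.1 ⟨(c, a), ha⟩ (pairing_le_fitzpatrick hAmax),
    fitzpatrick_normalCone hX hCb hCcl hCcv hne,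
    isBC_fitzpatrick isMonotoneOp_normalCone ⟨_, zero_mem_normalCone hc⟩
      (pairing_le_fitzpatrick_normalCone hX hCb hCcl hCcv hne)⟩,
    pairConj_add_pairConj hX hAmax hAlin hCb hCcl hCcv hne,
    fun x xs => ⟨fun v hv hx =>
      pairConj_partialInfConv_of_mem hX hAmax hAlin hAsv hCb hCcl hCcv hsub xs hv hx,
      pairConj_partialInfConv_of_notMem hX hAmax hAlin hAsv hCb hCcl hCcv hsub xs⟩,
    ?_, fun z zs hz v hv hpos =>
      pairConj_partialInfConv_lt hX hAmax hAlin hAsv hCb hCcl hCcv hsub hz hv hpos, ?_⟩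
  · obtain ⟨f, hf⟩ := exists_supportFn_pos hne hC0
    exact ⟨c, a + f, hc, a, ha, by rwa [add_sub_cancel_left]⟩
  · intro hH hC x y xs ys hxA hyN _ heq
    have hS := hH.strictConvexSpace
    -- The origin belongs to the graph, so `F_A` is nonnegative.
    have hx : 0 ≤ xs x := by
      rw [← EReal.coe_nonneg, ← show fitzpatrick A (x, xs) = ((xs x : ℝ) : EReal) from hxA]
      simpa using le_fitzpatrick hAlin.zero_mem (x, xs)
    obtain ⟨hy, hys⟩ := (fitzpatrick_normalCone_le_coe_iff hX hCb hCcl hCcv hne).1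
      (le_of_eq (show fitzpatrick (normalCone C) (y, ys) = ((ys y : ℝ) : EReal) from hyN))
    rw [hC] at hy hys
    refine ⟨norm_le_norm_add_of_norming hx (mem_closedBall_zero_iff.1 hy)
      (norm_le_of_forall_closedBall_le hys) heq, (hjge _).trans (hj ?_)⟩
    exact ((le_add_self.trans le_self_add).trans le_self_add)
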